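/- Let $n$ be a positive integer and let $\mathcal{C}$ be an additive and idempotent complete category. For $m\ge 1$: - A sequence $X_m\xrightarrow{f_m}\cdots\xrightarrow{f_2}X_1\xrightarrow{f_1}X_0$ in $\mathcal{C}$ is an *$m$-kernel* of a morphism $f\colon X_0\to Y$ if $0\to\mathcal{C}(-,X_m)\to\cdots\to\mathcal{C}(-,X_1)\to\mathcal{C}(-,X_0)\xrightarrow{\mathcal{C}(-,f)}\mathcal{C}(-,Y)$ is exact (that is, exact as a sequence of abelian groups at every object of $\mathcal{C}$). Dually, a sequence $Y_0\xrightarrow{g_1}Y_1\xrightarrow{g_2}\cdots\xrightarrow{g_m}Y_m$ is an *$m$-cokernel* of $f\colon X\to Y_0$ if $0\to\mathcal{C}(Y_m,-)\to\cdots\to\mathcal{C}(Y_1,-)\to\mathcal{C}(Y_0,-)\xrightarrow{\mathcal{C}(f,-)}\mathcal{C}(X,-)$ is exact. A sequence is called an $m$-kernel (respectively, $m$-cokernel) in $\mathcal{C}$ if it is an $m$-kernel (respectively, $m$-cokernel) of some morphism of $\mathcal{C}$. The category $\mathcal{C}$ *has $n$-kernels* (respectively, *has $n$-cokernels*) if every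 morphism of $\mathcal{C}$ has an $n$-kernel (respectively, an $n$-cokernel). - A sequence $X_m\xrightarrow{f_m}\cdots\xrightarrow{f_1}X_0$ is an *$m$-segment* if both $0\to\mathcal{C}(-,X_m)\to\cdots\to\mathcal{C}(-,X_0)$ and $\mathcal{C}(X_0,-)\to\mathcal{C}(X_1,-)\to\cdots\to\mathcal{C}(X_m,-)$ are exact. Dually, a sequence $Y_0\xrightarrow{g_1}\cdots\xrightarrow{g_m}Y_m$ is an *$m$-cosegment* if both $0\to\mathcal{C}(Y_m,-)\to\cdots\to\mathcal{C}(Y_0,-)$ and $\mathcal{C}(-,Y_0)\to\mathcal{C}(-,Y_1)\to\cdots\to\mathcal{C}(-,Y_m)$ are exact. - $\mathcal{C}$ is *$n$-abelian* if (A1) it has $n$-kernels; (A1$^{\mathrm{op}}$) it has $n$-cokernels; (A2) for every monomorphism $f\colon X\to Y$ and every $n$-cokernel $Y\xrightarrow{g_1}Y_1\to\cdots\xrightarrow{g_n}Y_n$ of $f$, the sequence $X\xrightarrow{f}Y\xrightarrow{g_1}\cdots\xrightarrow{g_{n-1}}Y_{n-1}$ is an $n$-kernel of $g_n$; and (A2$^{\mathrm{op}}$)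 for every epimorphism $f\colon X\to Y$ and every $n$-kernel $X_n\xrightarrow{f_n}\cdots\to X_1\xrightarrow{f_1}X$ of $f$, the sequence $X_{n-1}\xrightarrow{f_{n-1}}\cdots\xrightarrow{f_1}X\xrightarrow{f}Y$ is an $n$-cokernel of $f_n$. **Theorem.** The category $\mathcal{C}$ is $n$-abelian if and only if all of the following hold: $\mathcal{C}$ has $n$-kernels; $\mathcal{C}$ has $n$-cokernels; every $m$-segment in $\mathcal{C}$ is an $m$-kernel in $\mathcal{C}$, for all $1\le m\le n$; and every $m$-cosegment in $\mathcal{C}$ is an $m$-cokernel in $\mathcal{C}$, for all $1\le m\le n$. -/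

import Mathlib

open CategoryTheory CategoryTheory.Limits

universe v u

namespace HigherHomological

section

variable {C : Type u} [Category.{v} C] [Preadditive C]

/-- For a sequence `S₀ ⟶ S₁ ⟶ ⋯ ⟶ Sₘ`, the sequence of right modules
`C(-, S₀) ⟶ C(-, S₁) ⟶ ⋯ ⟶ C(-, Sₘ)` is exact, i.e. for every object `W` the sequence of
abelian groups `C(W, S₀) ⟶ ⋯ ⟶ C(W, Sₘ)` is exact at `C(W, S₁), …, C(W, Sₘ₋₁)`. -/
def ContravariantExact {m : ℕ} (S : ComposableArrows C m) : Prop :=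
  ∀ (i : ℕ) (_ : i + 2 ≤ m) (W : C),
    Function.Exact
      (fun x : W ⟶ S.obj' i => x ≫ S.map' i (i + 1))
      (fun x : W ⟶ S.obj' (i + 1) => x ≫ S.map' (i + 1) (i + 2))

/-- For a sequence `S₀ ⟶ S₁ ⟶ ⋯ ⟶ Sₘ`, the sequence of left modules
`C(Sₘ, -) ⟶ ⋯ ⟶ C(S₁, -) ⟶ C(S₀, -)` is exact (no condition at the two ends). -/
def CovariantExact {m : ℕ} (S : ComposableArrows C m) : Prop :=
  ∀ (i : ℕ) (_ : i + 2 ≤ m) (W : C),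
    Function.Exact
      (fun x : S.obj' (i + 2) ⟶ W => S.map' (i + 1) (i + 2) ≫ x)
      (fun x : S.obj' (i + 1) ⟶ W => S.map' i (i + 1) ≫ x)

/-- `0 ⟶ C(-, S₀) ⟶ C(-, S₁) ⟶ ⋯ ⟶ C(-, Sₘ)` is exact (for `m ≥ 1`). -/
def ContravariantLeftExact {m : ℕ} (S : ComposableArrows C m) : Prop :=
  (∀ (_ : 1 ≤ m) (W : C), Function.Injective (fun x : W ⟶ S.obj' 0 => x ≫ S.map' 0 1)) ∧
    ContravariantExact S

/-- `0 ⟶ C(Sₘ, -) ⟶ ⋯ ⟶ C(S₁, -) ⟶ C(S₀, -)` is exact (for `m ≥ 1`). -/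
def CovariantLeftExact {m : ℕ} (S : ComposableArrows C m) : Prop :=
  (∀ (i : ℕ) (_ : i + 1 = m) (W : C),
      Function.Injective (fun x : S.obj' (i + 1) ⟶ W => S.map' i (i + 1) ≫ x)) ∧
    CovariantExact S

/-- The sequence `S₀ ⟶ ⋯ ⟶ Sₘ` (with `m` morphisms, `m ≥ 1`) is an `m`-kernel of
`f : Sₘ ⟶ Y`: the sequence `0 ⟶ C(-, S₀) ⟶ ⋯ ⟶ C(-, Sₘ) ⟶ C(-, Y)` is exact. -/
def IsKernelSeq {m : ℕ} (S : ComposableArrows C m) {Y : C} (f : S.right ⟶ Y) : Prop :=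
  ContravariantLeftExact S ∧
    ∀ (i : ℕ) (_ : i + 1 = m) (W : C),
      Function.Exact
        (fun x : W ⟶ S.obj' i => (x ≫ S.map' i m : W ⟶ S.right))
        (fun x : W ⟶ S.right => x ≫ f)

/-- The sequence `S₀ ⟶ ⋯ ⟶ Sₘ` (with `m` morphisms, `m ≥ 1`) is an `m`-cokernel of
`f : X ⟶ S₀`: the sequence `0 ⟶ C(Sₘ, -) ⟶ ⋯ ⟶ C(S₀, -) ⟶ C(X, -)` is exact. -/
def IsCokernelSeq {m : ℕ} {X : C} (S : ComposableArrows C m) (f : X ⟶ S.left) : Prop :=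
  CovariantLeftExact S ∧
    ∀ (_ : 1 ≤ m) (W : C),
      Function.Exact
        (fun x : S.obj' 1 ⟶ W => (S.map' 0 1 ≫ x : S.left ⟶ W))
        (fun x : S.left ⟶ W => f ≫ x)

/-- `m`-segments (`m ≥ 1`), written `S₀ ⟶ ⋯ ⟶ Sₘ`. -/
def IsSegment {m : ℕ} (S : ComposableArrows C m) : Prop :=
  ContravariantLeftExact S ∧ CovariantExact S

/-- `m`-cosegments (`m ≥ 1`), written `S₀ ⟶ ⋯ ⟶ Sₘ`. -/
def IsCosegment {m : ℕ} (S : ComposableArrows C m) : Prop :=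
  CovariantLeftExact S ∧ ContravariantExact S

end

section

variable (C : Type u) [Category.{v} C] [Preadditive C]

/-- Every morphism has an `n`-kernel. -/
def HasNKernels (n : ℕ) : Prop :=
  ∀ ⦃X Y : C⦄ (f : X ⟶ Y),
    ∃ (S : ComposableArrows C n) (h : S.right = X), IsKernelSeq S (eqToHom h ≫ f)

/-- Every morphism has an `n`-cokernel. -/
def HasNCokernels (n : ℕ) : Prop :=
  ∀ ⦃X Y : C⦄ (f : X ⟶ Y),
    ∃ (S : ComposableArrows C n) (h : Y = S.left), IsCokernelSeq S (f ≫ eqToHom h)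

/-- `n`-abelian categories (`n ≥ 1`), among additive idempotent complete categories.
In the last two axioms a morphism together with an `n`-cokernel (or `n`-kernel) of it is
given as one sequence `T₀ ⟶ T₁ ⟶ ⋯ ⟶ Tₙ₊₁`; `T.δ₀` and `T.δlast` are the sequences
`T₁ ⟶ ⋯ ⟶ Tₙ₊₁` and `T₀ ⟶ ⋯ ⟶ Tₙ`. -/
structure IsNAbelian [HasFiniteBiproducts C] [IsIdempotentComplete C] (n : ℕ) : Prop where
  hasNKernels : HasNKernels C n
  hasNCokernels : HasNCokernels C n
  isKernelSeq_of_mono : ∀ T : ComposableArrows C (n + 1), Mono (T.map' 0 1) →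
    IsCokernelSeq T.δ₀ (T.map' 0 1) → IsKernelSeq T.δlast (T.map' n (n + 1))
  isCokernelSeq_of_epi : ∀ T : ComposableArrows C (n + 1), Epi (T.map' n (n + 1)) →
    IsKernelSeq T.δlast (T.map' n (n + 1)) → IsCokernelSeq T.δ₀ (T.map' 0 1)

end

end HigherHomological

namespace HigherHomological

section

variable {C : Type u} [Category.{v} C] [Preadditive C]

/-! (A2) says that a sequence of `n + 1` morphisms that starts with a monomorphism and is left exact
under `C(-, W)`-duality (covariantly) is also contravariantly left exact; (A2op) is the dual. If `C`
is `n`-abelian, the first morphism of a segment `S` is mono, and its `n`-cokernel extends it to a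
sequence `T` exact on both sides. Covariant exactness compares `S` with `T` up to homotopy, and `T`
has at least one more morphism than `S`. The next morphism of `T`, pulled back to the end of `S` and
paired with the homotopy defect there, is a morphism with kernel `S`
(`exists_isKernelSeq_of_isSegment`). Conversely, contravariant exactness of `T` spreads rightwards
from the initial mono: each initial piece already known to be exact is a segment, hence a kernel of
some `f`, and `f` factors through the next morphism of `T`
(`contravariantExact_of_isSegment_isKernelSeq`). Cosegments are dual. -/

lemma comp_eq_zero_of_contravariantExact {m : ℕ} {S : ComposableArrows C m}
    (hS : ContravariantExact S) (i : ℕ) (hi : i + 2 ≤ m) :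
    S.map' i (i + 1) ≫ S.map' (i + 1) (i + 2) = 0 :=
  (hS i hi _ _).2 ⟨𝟙 _, Category.id_comp _⟩

lemma comp_eq_zero_of_covariantExact {m : ℕ} {S : ComposableArrows C m}
    (hS : CovariantExact S) (i : ℕ) (hi : i + 2 ≤ m) :
    S.map' i (i + 1) ≫ S.map' (i + 1) (i + 2) = 0 :=
  (hS i hi _ _).2 ⟨𝟙 _, Category.comp_id _⟩

lemma exists_lift_of_contravariantExact {m : ℕ} {S : ComposableArrows C m}
    (hS : ContravariantExact S) (i : ℕ) (hi : i + 2 ≤ m) {W : C} (x : W ⟶ S.obj' (i + 1))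
    (hx : x ≫ S.map' (i + 1) (i + 2) = 0) : ∃ y : W ⟶ S.obj' i, y ≫ S.map' i (i + 1) = x :=
  (hS i hi W x).1 hx

lemma exists_desc_of_covariantExact {m : ℕ} {S : ComposableArrows C m}
    (hS : CovariantExact S) (i : ℕ) (hi : i + 2 ≤ m) {W : C} (x : S.obj' (i + 1) ⟶ W)
    (hx : S.map' i (i + 1) ≫ x = 0) : ∃ y : S.obj' (i + 2) ⟶ W, S.map' (i + 1) (i + 2) ≫ y = x :=
  (hS i hi W x).1 hx

lemma isKernelSeq_δlast_iff {n : ℕ} (hn : 1 ≤ n) (T : ComposableArrows C (n + 1)) :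
    IsKernelSeq T.δlast (T.map' n (n + 1)) ↔ ContravariantLeftExact T := by
  constructor
  · rintro ⟨⟨h₁, h₂⟩, h₃⟩
    refine ⟨fun _ W => h₁ hn W, fun i hi W => ?_⟩
    obtain hi' | hi' : i + 2 ≤ n ∨ i + 1 = n := by lia
    · exact h₂ i hi' W
    · subst hi'
      exact h₃ i rfl W
  · rintro ⟨h₁, h₂⟩
    refine ⟨⟨fun _ W => h₁ (by lia) W, fun i hi W => h₂ i (by lia) W⟩, fun i hi W => ?_⟩
    subst hi
    exact h₂ i (by lia) W

lemma isCokernelSeq_δ₀_iff {n : ℕ} (hn : 1 ≤ n) (T : ComposableArrows C (n + 1)) :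
    IsCokernelSeq T.δ₀ (T.map' 0 1) ↔ CovariantLeftExact T := by
  constructor
  · rintro ⟨⟨h₁, h₂⟩, h₃⟩
    refine ⟨fun i hi W => ?_, fun i hi W => ?_⟩
    · obtain _ | i := i
      · lia
      · exact h₁ i (by lia) W
    · obtain _ | i := i
      · exact h₃ hn W
      · exact h₂ i (by lia) W
  · rintro ⟨h₁, h₂⟩
    exact ⟨⟨fun i hi W => h₁ (i + 1) (by lia) W, fun i hi W => h₂ (i + 1) (by lia) W⟩,
      fun _ W => h₂ 0 (by lia) W⟩

/-- Any morphism out of the last object of a sequence can be appended to it. -/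
lemma exists_append {C : Type u} [Category.{v} C] {n : ℕ} (K : ComposableArrows C n)
    {Y : C} (g : K.right ⟶ Y) :
    ∃ T : ComposableArrows C (n + 1),
      (⟨T.δlast, T.obj' (n + 1), T.map' n (n + 1)⟩ :
        Σ (K : ComposableArrows C n) (Y : C), (K.right ⟶ Y)) = ⟨K, Y, g⟩ := by
  induction n with
  | zero =>
    obtain ⟨X, rfl⟩ := K.mk₀_surjective
    exact ⟨.mk₁ g, Sigma.ext (ComposableArrows.ext₀ rfl) HEq.rfl⟩
  | succ n ih =>
    obtain ⟨K, X, f, rfl⟩ := K.precomp_surjective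
    obtain ⟨T, hT⟩ := ih K g
    cases hT
    exact ⟨T.precomp f, Sigma.ext (ComposableArrows.ext_succ rfl rfl
      ((Category.comp_id f).symm.trans (Category.id_comp _).symm)) HEq.rfl⟩

lemma exists_append_isKernelSeq {n : ℕ} (K : ComposableArrows C n) {X Y : C} (e : K.right ≅ X)
    (p : X ⟶ Y) (hK : IsKernelSeq K (e.hom ≫ p)) :
    ∃ (T : ComposableArrows C (n + 1)) (e₀ : X ≅ T.obj' n) (e₁ : Y ≅ T.obj' (n + 1)),
      p ≫ e₁.hom = e₀.hom ≫ T.map' n (n + 1) ∧ IsKernelSeq T.δlast (T.map' n (n + 1)) := by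
  -- With the composite generalised to a variable `g`, `cases hT` can replace `K`, `Y`, `g` by the
  -- parts of `T`, avoiding transport along equalities of objects.
  obtain ⟨g, hg⟩ : ∃ g, g = e.hom ≫ p := ⟨_, rfl⟩
  rw [← hg] at hK
  rw [← Iso.inv_comp_eq] at hg
  obtain ⟨T, hT⟩ := exists_append K g
  cases hT
  exact ⟨T, e.symm, Iso.refl _, (Category.comp_id p).trans hg.symm, hK⟩

/-! ### Comparison of exact sequences up to homotopy -/

/-- Two morphisms are related by commutative squares in both directions, such that the composite
endomorphism of the target of `d` is homotopic to the identity after precomposition with `d`. -/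
def AgreeUpToHomotopyTarget {A A' B B' : C} (d : A ⟶ A') (d' : B ⟶ B') : Prop :=
  ∃ (φ : A ⟶ B) (φ' : A' ⟶ B') (ψ : B ⟶ A) (ψ' : B' ⟶ A') (h : A' ⟶ A),
    d ≫ φ' = φ ≫ d' ∧ d' ≫ ψ' = ψ ≫ d ∧ d ≫ (φ' ≫ ψ' - 𝟙 A' - h ≫ d) = 0

/-- Two morphisms are related by commutative squares in both directions, such that the composite
endomorphism of the source of `d` is homotopic to the identity after postcomposition with `d`. -/
def AgreeUpToHomotopySource {A A' B B' : C} (d : A ⟶ A') (d' : B ⟶ B') : Prop :=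
  ∃ (φ : A ⟶ B) (φ' : A' ⟶ B') (ψ : B ⟶ A) (ψ' : B' ⟶ A') (h : A' ⟶ A),
    d ≫ φ' = φ ≫ d' ∧ d' ≫ ψ' = ψ ≫ d ∧ (φ ≫ ψ - 𝟙 A - d ≫ h) ≫ d = 0

/-- Comparison, up to homotopy, of two covariantly exact sequences which agree in
degrees `0` and `1`. -/
lemma exists_comparison_of_covariantExact {m N : ℕ} {S : ComposableArrows C (m + 1)}
    {T : ComposableArrows C N} (hmN : m + 1 ≤ N) (hS : CovariantExact S) (hT : CovariantExact T)
    (e₀ : S.obj' 0 ≅ T.obj' 0) (e₁ : S.obj' 1 ≅ T.obj' 1)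
    (w : S.map' 0 1 ≫ e₁.hom = e₀.hom ≫ T.map' 0 1) (j : ℕ) (hj : j ≤ m) :
    AgreeUpToHomotopyTarget (S.map' j (j + 1)) (T.map' j (j + 1)) := by
  induction j with
  | zero =>
    refine ⟨e₀.hom, e₁.hom, e₀.inv, e₁.inv, 0, w, ?_,
      by rw [Iso.hom_inv_id, zero_comp, sub_self, sub_zero, comp_zero]⟩
    rw [Iso.eq_inv_comp, ← reassoc_of% w, e₁.hom_inv_id, Category.comp_id]
  | succ j ih =>
    obtain ⟨φ', φ, ψ', ψ, h, hφ, hψ, hh⟩ := ih (by lia)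
    obtain ⟨φ₂, hφ₂⟩ := exists_desc_of_covariantExact hS j (by lia)
      (φ ≫ T.map' (j + 1) (j + 2)) (by
        rw [reassoc_of% hφ, comp_eq_zero_of_covariantExact hT j (by lia), comp_zero])
    obtain ⟨ψ₂, hψ₂⟩ := exists_desc_of_covariantExact hT j (by lia)
      (ψ ≫ S.map' (j + 1) (j + 2)) (by
        rw [reassoc_of% hψ, comp_eq_zero_of_covariantExact hS j (by lia), comp_zero])
    -- The defect `φ ≫ ψ - 𝟙 - h ≫ d` is killed by the incoming morphism, so it factors through the
    -- outgoing one; the factor is the next homotopy.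
    obtain ⟨h₂, hh₂⟩ := exists_desc_of_covariantExact hS j (by lia) _ hh
    refine ⟨φ, φ₂, ψ, ψ₂, h₂, hφ₂, hψ₂, ?_⟩
    have hz := comp_eq_zero_of_covariantExact hS j (by lia)
    simp only [Preadditive.comp_sub, Category.comp_id]
    rw [reassoc_of% hφ₂, hψ₂, reassoc_of% hh₂]
    simp only [Preadditive.sub_comp, Category.id_comp, Category.assoc, hz, comp_zero]
    abel

/-- Comparison, up to homotopy, of two contravariantly exact sequences which agree in
the last two degrees. -/
lemma exists_comparison_of_contravariantExact {m N : ℕ} {S : ComposableArrows C (m + 1)}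
    {T : ComposableArrows C (N + 1)} (hS : ContravariantExact S)
    (hT : ContravariantExact T) (e₀ : S.obj' m ≅ T.obj' N) (e₁ : S.obj' (m + 1) ≅ T.obj' (N + 1))
    (w : S.map' m (m + 1) ≫ e₁.hom = e₀.hom ≫ T.map' N (N + 1)) (j : ℕ) :
    ∀ (a b : ℕ) (_ : a + j = m) (_ : b + j = N),
      AgreeUpToHomotopySource (S.map' a (a + 1)) (T.map' b (b + 1)) := by
  -- `j` counts positions back from the right end, where the sequences agree; `a` and `b` are the
  -- matching positions, since the lengths may differ.
  induction j with
  | zero =>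
    rintro a b rfl rfl
    refine ⟨e₀.hom, e₁.hom, e₀.inv, e₁.inv, 0, w, ?_,
      by rw [Iso.hom_inv_id, comp_zero, sub_self, sub_zero, zero_comp]⟩
    rw [Iso.eq_inv_comp, ← reassoc_of% w, e₁.hom_inv_id, Category.comp_id]
  | succ j ih =>
    intro a b ha hb
    obtain ⟨φ, φ', ψ, ψ', h, hφ, hψ, hh⟩ := ih (a + 1) (b + 1) (by lia) (by lia)
    obtain ⟨φ₂, hφ₂⟩ := exists_lift_of_contravariantExact hT b (by lia)
      (S.map' a (a + 1) ≫ φ) (by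
        rw [Category.assoc, ← hφ, ← Category.assoc,
          comp_eq_zero_of_contravariantExact hS a (by lia), zero_comp])
    obtain ⟨ψ₂, hψ₂⟩ := exists_lift_of_contravariantExact hS a (by lia)
      (T.map' b (b + 1) ≫ ψ) (by
        rw [Category.assoc, ← hψ, ← Category.assoc,
          comp_eq_zero_of_contravariantExact hT b (by lia), zero_comp])
    obtain ⟨h₂, hh₂⟩ := exists_lift_of_contravariantExact hS a (by lia) _ hh
    refine ⟨φ₂, φ, ψ₂, ψ, h₂, hφ₂.symm, hψ₂.symm, ?_⟩
    have hz := comp_eq_zero_of_contravariantExact hS a (by lia)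
    simp only [Preadditive.sub_comp, Category.id_comp, Category.assoc]
    rw [hψ₂, ← Category.assoc, hφ₂, hh₂]
    simp only [Preadditive.comp_sub, Category.comp_id, Category.assoc, reassoc_of% hz, zero_comp]
    abel

/-! ### Segments are kernels, cosegments are cokernels -/

lemma exists_isKernelSeq_of_isSegment [HasFiniteBiproducts C] {m N : ℕ}
    {S : ComposableArrows C (m + 1)} {T : ComposableArrows C N} (hmN : m + 2 ≤ N)
    (hS : IsSegment S) (hT : CovariantExact T) (hT' : ContravariantExact T)
    (e₀ : S.obj' 0 ≅ T.obj' 0) (e₁ : S.obj' 1 ≅ T.obj' 1)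
    (w : S.map' 0 1 ≫ e₁.hom = e₀.hom ≫ T.map' 0 1) :
    ∃ (Y : C) (f : S.right ⟶ Y), IsKernelSeq S f := by
  have := hasBinaryBiproducts_of_finite_biproducts C
  obtain ⟨φ', φ, ψ', ψ, h, hφ, hψ, hh⟩ :=
    exists_comparison_of_covariantExact (by lia) hS.2 hT e₀ e₁ w m le_rfl
  -- `S` has no further morphism through which the defect could factor, so the defect becomes a
  -- second component. If both components kill `x`, then `x ≫ φ` lifts to some `z` along `T`, and `x
  -- = x ≫ φ ≫ ψ - x ≫ h ≫ d` factors through `d` as `(z ≫ ψ' - x ≫ h) ≫ d`.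
  refine ⟨_, biprod.lift (φ ≫ T.map' (m + 1) (m + 2))
    (φ ≫ ψ - 𝟙 _ - h ≫ S.map' m (m + 1)), hS.1, ?_⟩
  rintro i hi W x
  obtain rfl : i = m := by lia
  constructor
  · intro hx
    have h₁ : (x ≫ φ) ≫ T.map' (i + 1) (i + 2) = 0 := by
      simpa using hx =≫ biprod.fst
    have h₂ : x ≫ (φ ≫ ψ - 𝟙 _ - h ≫ S.map' i (i + 1)) = 0 := by
      rw [← biprod.lift_snd (φ ≫ T.map' (i + 1) (i + 2))
        (φ ≫ ψ - 𝟙 _ - h ≫ S.map' i (i + 1)), ← Category.assoc]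
      exact (hx =≫ biprod.snd).trans zero_comp
    obtain ⟨z, hz⟩ := exists_lift_of_contravariantExact hT' i (by lia) _ h₁
    refine ⟨z ≫ ψ' - x ≫ h, ?_⟩
    simp only [Preadditive.comp_sub, Category.comp_id] at h₂
    simp only [Preadditive.sub_comp, Category.assoc]
    rw [← hψ, reassoc_of% hz, ← sub_eq_zero, ← h₂]
    abel
  · rintro ⟨y, rfl⟩
    have h₁ : S.map' i (i + 1) ≫ φ ≫ T.map' (i + 1) (i + 2) = 0 := by
      rw [reassoc_of% hφ, comp_eq_zero_of_contravariantExact hT' i (by lia), comp_zero]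
    have h₂ : S.map' i (i + 1) ≫ biprod.lift (φ ≫ T.map' (i + 1) (i + 2))
        (φ ≫ ψ - 𝟙 _ - h ≫ S.map' i (i + 1)) = 0 := by
      ext
      · rw [Category.assoc, biprod.lift_fst, h₁, zero_comp]
      · rw [Category.assoc, biprod.lift_snd, hh, zero_comp]
    exact (Category.assoc _ _ _).trans ((congrArg (y ≫ ·) h₂).trans comp_zero)

lemma exists_isCokernelSeq_of_isCosegment [HasFiniteBiproducts C] {m N : ℕ}
    {S : ComposableArrows C (m + 1)} {T : ComposableArrows C (N + 1)} (hmN : m + 1 ≤ N)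
    (hS : IsCosegment S) (hT : CovariantExact T) (hT' : ContravariantExact T)
    (e₀ : S.obj' m ≅ T.obj' N) (e₁ : S.obj' (m + 1) ≅ T.obj' (N + 1))
    (w : S.map' m (m + 1) ≫ e₁.hom = e₀.hom ≫ T.map' N (N + 1)) :
    ∃ (X : C) (f : X ⟶ S.left), IsCokernelSeq S f := by
  have := hasBinaryBiproducts_of_finite_biproducts C
  -- Position `b + 1` of `T` matches position `0` of `S`; the spare position `b` supplies the source
  -- of the first component.
  obtain ⟨b, hb⟩ : ∃ b, b + 1 + m = N := ⟨N - m - 1, by lia⟩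
  obtain ⟨φ, φ', ψ, ψ', h, hφ, hψ, hh⟩ :=
    exists_comparison_of_contravariantExact hS.2 hT' e₀ e₁ w m 0 (b + 1) (by lia) hb
  have hz : T.map' b (b + 1) ≫ ψ ≫ S.map' 0 1 = 0 := by
    rw [← hψ, ← Category.assoc, comp_eq_zero_of_covariantExact hT b (by lia), zero_comp]
  refine ⟨_, biprod.desc (T.map' b (b + 1) ≫ ψ) (φ ≫ ψ - 𝟙 _ - S.map' 0 1 ≫ h), hS.1, ?_⟩
  rintro - W x
  constructor
  · intro hx
    have h₁ : T.map' b (b + 1) ≫ ψ ≫ x = 0 := by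
      rw [← Category.assoc, ← biprod.inl_desc (T.map' b (b + 1) ≫ ψ)
        (φ ≫ ψ - 𝟙 _ - S.map' 0 1 ≫ h), Category.assoc]
      exact (biprod.inl ≫= hx).trans comp_zero
    have h₂ : (φ ≫ ψ - 𝟙 _ - S.map' 0 1 ≫ h) ≫ x = 0 := by
      rw [← biprod.inr_desc (T.map' b (b + 1) ≫ ψ)
        (φ ≫ ψ - 𝟙 _ - S.map' 0 1 ≫ h), Category.assoc]
      exact (biprod.inr ≫= hx).trans comp_zero
    obtain ⟨z, hz⟩ := exists_desc_of_covariantExact hT b (by lia) _ h₁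
    refine ⟨φ' ≫ z - h ≫ x, ?_⟩
    simp only [Preadditive.sub_comp, Category.id_comp, Category.assoc] at h₂
    simp only [Preadditive.comp_sub]
    rw [reassoc_of% hφ, hz, ← sub_eq_zero, ← h₂]
    abel
  · rintro ⟨y, rfl⟩
    have h₂ : biprod.desc (T.map' b (b + 1) ≫ ψ) (φ ≫ ψ - 𝟙 _ - S.map' 0 1 ≫ h) ≫
        S.map' 0 1 = 0 := by
      ext
      · rw [biprod.inl_desc_assoc, Category.assoc, hz, comp_zero]
      · rw [biprod.inr_desc_assoc, hh, comp_zero]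
    exact (Category.assoc _ _ _).symm.trans ((congrArg (· ≫ y) h₂).trans zero_comp)

/-! ### One-sided exactness implies two-sided exactness -/

/-- The first `k` morphisms of a sequence. -/
abbrev initialSegment {N : ℕ} (T : ComposableArrows C N) (k : ℕ) (hk : k ≤ N) :
    ComposableArrows C k :=
  T.whiskerLeft (Fin.castLEOrderEmb (Nat.succ_le_succ hk)).monotone.functor

lemma contravariantExact_of_isSegment_isKernelSeq {n : ℕ}
    (H : ∀ m : ℕ, 1 ≤ m → m ≤ n → ∀ S : ComposableArrows C m, IsSegment S →
      ∃ (Y : C) (f : S.right ⟶ Y), IsKernelSeq S f)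
    (T : ComposableArrows C (n + 1)) [hm : Mono (T.map' 0 1)] (hT : CovariantExact T) :
    ContravariantExact T := by
  suffices ∀ k ≤ n + 1, ∀ (i : ℕ) (_ : i + 2 ≤ k) (_ : k ≤ n + 1) (W : C),
      Function.Exact (fun x : W ⟶ T.obj' i => x ≫ T.map' i (i + 1))
        (fun x : W ⟶ T.obj' (i + 1) => x ≫ T.map' (i + 1) (i + 2)) from
    fun i hi W => this (n + 1) le_rfl i hi le_rfl W
  intro k
  induction k with
  | zero => intro _ i hi; lia
  | succ k ih =>
    intro hk i hi _ W
    obtain hi' | hi' : i + 2 ≤ k ∨ i + 1 = k := by lia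
    · exact ih (by lia) i hi' (by lia) W
    subst hi'
    obtain ⟨Y, f, hf⟩ := H (i + 1) (by lia) (by lia) (initialSegment T (i + 1) (by lia))
      ⟨⟨fun _ W a b hab => hm.right_cancellation a b hab,
        fun j hj W => ih (by lia) j hj (by lia) W⟩, fun j hj W => hT j (by lia) W⟩
    have hf' : ∀ (W : C), Function.Exact (fun x : W ⟶ T.obj' i => x ≫ T.map' i (i + 1))
      (fun x : W ⟶ T.obj' (i + 1) => x ≫ f) := hf.2 i rfl
    -- Since `f` factors through the next morphism of `T`, whatever that morphism kills is killed by
    -- `f`, hence comes from the preceding term.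
    obtain ⟨g, hg⟩ := exists_desc_of_covariantExact hT i (by lia) f
      ((hf' _ _).2 ⟨𝟙 _, Category.id_comp _⟩)
    intro x
    constructor
    · intro hx
      refine (hf' W x).1 ?_
      dsimp only at hx ⊢
      rw [← hg, ← Category.assoc, hx, zero_comp]
    · rintro ⟨y, rfl⟩
      exact (Category.assoc _ _ _).trans
        ((congrArg (y ≫ ·) (comp_eq_zero_of_covariantExact hT i (by lia))).trans comp_zero)

lemma covariantExact_of_isCosegment_isCokernelSeq {n : ℕ}
    (H : ∀ m : ℕ, 1 ≤ m → m ≤ n → ∀ S : ComposableArrows C m, IsCosegment S →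
      ∃ (X : C) (f : X ⟶ S.left), IsCokernelSeq S f)
    (T : ComposableArrows C (n + 1)) [hm : Epi (T.map' n (n + 1))]
    (hT : ContravariantExact T) :
    CovariantExact T := by
  -- Exactness now spreads leftwards from the final epimorphism, so `k` bounds the distance of `i`
  -- from the right end.
  suffices ∀ k ≤ n + 1, ∀ (i : ℕ) (_ : n + 1 ≤ i + k) (_ : i + 2 ≤ n + 1) (W : C),
      Function.Exact (fun x : T.obj' (i + 2) ⟶ W => T.map' (i + 1) (i + 2) ≫ x)
        (fun x : T.obj' (i + 1) ⟶ W => T.map' i (i + 1) ≫ x) from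
    fun i hi W => this (n + 1) le_rfl i (by lia) hi W
  intro k
  induction k with
  | zero => intro _ i hi; lia
  | succ k ih =>
    intro hk i hi hi₂ W
    obtain hi' | hi' : n + 1 ≤ i + k ∨ n = i + k := by lia
    · exact ih (by lia) i hi' (by lia) W
    subst hi'
    have hki : (i + 1) + k ≤ i + k + 1 := by lia
    have hm' : ∀ (j : ℕ) (_ : j = i + k), Epi (T.map' j (j + 1)) := by
      rintro _ rfl
      exact hm
    obtain ⟨X, (f : X ⟶ T.obj' (i + 1)), hf⟩ := H k (by lia) (by lia)
      ((ComposableArrows.natAddLEFunctor hki).obj T)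
      ⟨⟨fun j hj W a b hab => by
          exact (hm' (i + 1 + j) (by lia)).left_cancellation a b hab,
        fun j hj W => ih (by lia) (i + 1 + j) (by lia) (by lia) W⟩,
        fun j hj W => hT (i + 1 + j) (by lia) W⟩
    have hf' : ∀ (W : C), Function.Exact
      (fun x : T.obj' (i + 2) ⟶ W => T.map' (i + 1) (i + 2) ≫ x)
      (fun x : T.obj' (i + 1) ⟶ W => f ≫ x) := hf.2 (by lia)
    obtain ⟨g, hg⟩ := exists_lift_of_contravariantExact hT i (by lia) f
      ((hf' _ _).2 ⟨𝟙 _, Category.comp_id _⟩)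
    intro x
    constructor
    · intro hx
      refine (hf' W x).1 ?_
      dsimp only at hx ⊢
      rw [← hg, Category.assoc, hx, comp_zero]
    · rintro ⟨y, rfl⟩
      exact (Category.assoc _ _ _).symm.trans
        ((congrArg (· ≫ y) (comp_eq_zero_of_contravariantExact hT i (by lia))).trans zero_comp)

/-! ### Consequences of the `n`-abelian axioms -/

namespace IsNAbelian

variable [HasFiniteBiproducts C] [IsIdempotentComplete C] {n : ℕ}

lemma exists_isKernelSeq (hC : IsNAbelian C n) {m : ℕ} (hm : 1 ≤ m) (hmn : m ≤ n)
    (S : ComposableArrows C m) (hS : IsSegment S) :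
    ∃ (Y : C) (f : S.right ⟶ Y), IsKernelSeq S f := by
  obtain ⟨m, rfl⟩ := Nat.exists_eq_add_of_le' hm
  obtain ⟨K, h, hK⟩ := hC.hasNCokernels (S.map' 0 1)
  have hS₀ : Mono (S.map' 0 1) := ⟨fun {W} a b hab => hS.1.1 hm W hab⟩
  let T : ComposableArrows C (n + 1) := K.precomp (S.map' 0 1 ≫ eqToHom h)
  have hT₀ : Mono (T.map' 0 1 (by lia) (by lia)) :=
    @mono_comp _ _ _ _ _ _ hS₀ _ (IsIso.mono_of_iso (eqToIso h).hom)
  have hT : IsCokernelSeq T.δ₀ (T.map' 0 1) := hK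
  have hT' := hC.isKernelSeq_of_mono T hT₀ hT
  rw [isCokernelSeq_δ₀_iff (by lia)] at hT
  rw [isKernelSeq_δlast_iff (by lia)] at hT'
  exact exists_isKernelSeq_of_isSegment (by lia) hS hT.2 hT'.2 (Iso.refl _) (eqToIso h)
    (Category.id_comp _).symm

lemma exists_isCokernelSeq (hC : IsNAbelian C n) {m : ℕ} (hm : 1 ≤ m) (hmn : m ≤ n)
    (S : ComposableArrows C m) (hS : IsCosegment S) :
    ∃ (X : C) (f : X ⟶ S.left), IsCokernelSeq S f := by
  obtain ⟨m, rfl⟩ := Nat.exists_eq_add_of_le' hm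
  obtain ⟨K, h, hK⟩ := hC.hasNKernels (S.map' m (m + 1))
  have hS₀ : Epi (S.map' m (m + 1)) := ⟨fun {W} a b hab => hS.1.1 m rfl W hab⟩
  obtain ⟨T, e₀, e₁, w, hT⟩ := exists_append_isKernelSeq K (eqToIso h) (S.map' m (m + 1)) hK
  have hT₀ : Epi (T.map' n (n + 1)) := by
    rw [← Iso.inv_comp_eq] at w
    rw [← w]
    infer_instance
  have hT' := hC.isCokernelSeq_of_epi T hT₀ hT
  rw [isKernelSeq_δlast_iff (by lia)] at hT
  rw [isCokernelSeq_δ₀_iff (by lia)] at hT'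
  exact exists_isCokernelSeq_of_isCosegment (by lia) hS hT'.2 hT.2 e₀ e₁ w

end IsNAbelian

end

end HigherHomological

theorem theorem8 {C : Type u} [Category.{v} C] [Preadditive C] [HasFiniteBiproducts C]
    [IsIdempotentComplete C] (n : ℕ) (hn : 1 ≤ n) :
    HigherHomological.IsNAbelian C n ↔
      HigherHomological.HasNKernels C n ∧
      HigherHomological.HasNCokernels C n ∧
      (∀ m : ℕ, 1 ≤ m → m ≤ n → ∀ S : ComposableArrows C m, HigherHomological.IsSegment S →
        ∃ (Y : C) (f : S.right ⟶ Y), HigherHomological.IsKernelSeq S f) ∧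
      (∀ m : ℕ, 1 ≤ m → m ≤ n → ∀ S : ComposableArrows C m, HigherHomological.IsCosegment S →
        ∃ (X : C) (f : X ⟶ S.left), HigherHomological.IsCokernelSeq S f) := by
  open HigherHomological in
  constructor
  · intro hC
    exact ⟨hC.hasNKernels, hC.hasNCokernels, fun m hm hmn => hC.exists_isKernelSeq hm hmn,
      fun m hm hmn => hC.exists_isCokernelSeq hm hmn⟩
  · rintro ⟨h₁, h₂, h₃, h₄⟩
    refine ⟨h₁, h₂, fun T hT hT' => ?_, fun T hT hT' => ?_⟩
    · rw [isCokernelSeq_δ₀_iff hn] at hT'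
      rw [isKernelSeq_δlast_iff hn]
      exact ⟨fun _ W a b hab => hT.right_cancellation a b hab,
        contravariantExact_of_isSegment_isKernelSeq h₃ T hT'.2⟩
    · rw [isKernelSeq_δlast_iff hn] at hT'
      rw [isCokernelSeq_δ₀_iff hn]
      refine ⟨fun i hi W a b hab => ?_, covariantExact_of_isCosegment_isCokernelSeq h₄ T hT'.2⟩
      obtain rfl : i = n := by lia
      exact hT.left_cancellation a b hab
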